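/- For a partition $\mu$ write $\mu_1\ge\mu_2\ge\cdots$ for its parts and $\ell(\mu)$ for the number of its nonzero parts, and let $s_\mu$ denote the Schur function. For partitions $\mu,\nu$ and $n=\max(\ell(\mu),\ell(\nu))$, define partitions $\lambda=\lambda(\mu,\nu)$ and $\rho=\rho(\mu,\nu)$ with at most $n$ parts by $$\lambda_k=\mu_k-k+\#\{j : 1\le j\le n,\ \nu_j-j\ge\mu_k-k\},\qquad \rho_j=\nu_j-j+1+\#\{k : 1\le k\le n,\ \mu_k-k>\nu_j-j\}$$ for $1\le k,j\le n$. Say that the Fomin–Fulton–Li–Poon conjecture holds for the ordered pair $(\mu,\nu)$ if $s_\lambda s_\rho-s_\mu s_\nu$ is Schur-positive, i.e. a linear combination of Schur functions with nonnegative integer coefficients. **Theorem 3.2.** Let $p$ be a positive integer and let $\nu$ be a partition with $\ell(\nu)\le p$. There are only finitely many partitions $\alpha$ with $\ell(\alpha)\le p$ and $\alpha_1\le p(\nu_1+p)$, and the conjecture holds for all pairs $(\mu,\nu)$ with $\ell(\mu)\le p$ if and only if it holds for all pairs $(\alpha,\nu)$ with $\ell(\alpha)\le p$ and $\alpha_1\le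 p(\nu_1+p)$. -/

import Mathlib

namespace FFLP

/-! Partitions are Mathlib's Young diagrams: the parts of `μ` are `μ.rowLen 0 ≥ μ.rowLen 1 ≥ ⋯`
(numbered from `0`), and the number `ℓ(μ)` of nonzero parts is `μ.colLen 0`. -/

/-! ### The `*`-operation -/

/-- A common number of parts of `μ` and `ν` (zero parts being allowed). -/
def numParts (μ ν : YoungDiagram) : ℕ := max (μ.colLen 0) (ν.colLen 0)

/-- With `k = i + 1`, the integer `μ_k - k`. -/
def shifted (μ : YoungDiagram) (i : ℕ) : ℤ := (μ.rowLen i : ℤ) - ((i : ℤ) + 1)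

/-- With `k = i + 1`, the integer `λ_k = μ_k - k + #{j | 1 ≤ j ≤ n, ν_j - j ≥ μ_k - k}`. -/
def lambdaPart (μ ν : YoungDiagram) (i : ℕ) : ℤ :=
  shifted μ i + (((Finset.range (numParts μ ν)).filter
    (fun j => shifted μ i ≤ shifted ν j)).card : ℤ)

/-- With `j = i + 1`, the integer `ρ_j = ν_j - j + 1 + #{k | 1 ≤ k ≤ n, μ_k - k > ν_j - j}`. -/
def rhoPart (μ ν : YoungDiagram) (i : ℕ) : ℤ :=
  shifted ν i + 1 + (((Finset.range (numParts μ ν)).filter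
    (fun k => shifted ν i < shifted μ k)).card : ℤ)

theorem shifted_strictAnti (μ : YoungDiagram) : StrictAnti (shifted μ) := by
  intro i j hij
  have := μ.rowLen_anti i j hij.le
  unfold shifted
  omega

theorem card_filter_Ico_le (μ : YoungDiagram) (n : ℕ) {a b : ℤ} (hab : b ≤ a) :
    (((Finset.range n).filter (fun j => b ≤ shifted μ j ∧ shifted μ j < a)).card : ℤ)
      ≤ a - b := by
  have h : ((Finset.range n).filter (fun j => b ≤ shifted μ j ∧ shifted μ j < a)).card
      ≤ (Finset.Ico b a).card := by
    refine Finset.card_le_card_of_injOn (shifted μ) ?_ (shifted_strictAnti μ).injective.injOn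
    intro j hj
    simp only [Finset.coe_filter, Set.mem_ofPred_eq] at hj
    simpa using hj.2
  rw [Int.card_Ico] at h
  omega

theorem lambdaPart_antitone (μ ν : YoungDiagram) : Antitone (lambdaPart μ ν) := by
  intro i j hij
  have hs := (shifted_strictAnti μ).antitone hij
  have h1 := card_filter_Ico_le ν (numParts μ ν) hs
  have h2 : ((Finset.range (numParts μ ν)).filter
      (fun l => shifted μ j ≤ shifted ν l)).card ≤
      ((Finset.range (numParts μ ν)).filter
        (fun l => shifted μ j ≤ shifted ν l ∧ shifted ν l < shifted μ i)).card +
      ((Finset.range (numParts μ ν)).filter (fun l => shifted μ i ≤ shifted ν l)).card := by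
    refine le_trans (Finset.card_le_card ?_) (Finset.card_union_le _ _)
    intro l
    simp only [Finset.mem_filter, Finset.mem_union]
    grind
  unfold lambdaPart
  omega

theorem rhoPart_antitone (μ ν : YoungDiagram) : Antitone (rhoPart μ ν) := by
  intro i j hij
  have hs := (shifted_strictAnti ν).antitone hij
  have h1 := card_filter_Ico_le μ (numParts μ ν) (a := shifted ν i + 1) (b := shifted ν j + 1)
    (by omega)
  have h2 : ((Finset.range (numParts μ ν)).filter
      (fun l => shifted ν j < shifted μ l)).card ≤
      ((Finset.range (numParts μ ν)).filter
        (fun l => shifted ν j + 1 ≤ shifted μ l ∧ shifted μ l < shifted ν i + 1)).card +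
      ((Finset.range (numParts μ ν)).filter (fun l => shifted ν i < shifted μ l)).card := by
    refine le_trans (Finset.card_le_card ?_) (Finset.card_union_le _ _)
    intro l
    simp only [Finset.mem_filter, Finset.mem_union]
    grind
  unfold rhoPart
  omega

theorem sortedGE_map_toNat {f : ℕ → ℤ} (hf : Antitone f) (n : ℕ) :
    ((List.range n).map (fun i => (f i).toNat)).SortedGE :=
  (List.pairwise_le_range.map (S := fun x y : ℕ => x ≥ y) _
    (fun _ _ h => Int.toNat_le_toNat (hf h))).sortedGE

/-- The partition `λ(μ, ν)`, first entry of `(μ, ν)^*`. -/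
def lambda (μ ν : YoungDiagram) : YoungDiagram :=
  YoungDiagram.ofRowLens ((List.range (numParts μ ν)).map (fun i => (lambdaPart μ ν i).toNat))
    (sortedGE_map_toNat (lambdaPart_antitone μ ν) _)

/-- The partition `ρ(μ, ν)`, second entry of `(μ, ν)^*`. -/
def rho (μ ν : YoungDiagram) : YoungDiagram :=
  YoungDiagram.ofRowLens ((List.range (numParts μ ν)).map (fun i => (rhoPart μ ν i).toNat))
    (sortedGE_map_toNat (rhoPart_antitone μ ν) _)

/-- The parts `λ_1, …, λ_n` are nonnegative, so that `Int.toNat` does not truncate them. -/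
theorem lambdaPart_nonneg (μ ν : YoungDiagram) {i : ℕ} (hi : i < numParts μ ν) :
    0 ≤ lambdaPart μ ν i := by
  by_cases hm : μ.rowLen i ≤ i
  · have : (Finset.range (i + 1 - μ.rowLen i)).card ≤ ((Finset.range (numParts μ ν)).filter
        (fun j => shifted μ i ≤ shifted ν j)).card := by
      apply Finset.card_le_card
      intro j hj
      rw [Finset.mem_range] at hj
      refine Finset.mem_filter.mpr ⟨Finset.mem_range.mpr (by omega), ?_⟩
      unfold shifted
      omega
    rw [Finset.card_range] at this
    unfold lambdaPart
    have hs : shifted μ i = (μ.rowLen i : ℤ) - ((i : ℤ) + 1) := rfl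
    omega
  · unfold lambdaPart
    have hs : shifted μ i = (μ.rowLen i : ℤ) - ((i : ℤ) + 1) := rfl
    omega

/-- The parts `ρ_1, …, ρ_n` are nonnegative, so that `Int.toNat` does not truncate them. -/
theorem rhoPart_nonneg (μ ν : YoungDiagram) {i : ℕ} (hi : i < numParts μ ν) :
    0 ≤ rhoPart μ ν i := by
  have hs : shifted ν i = (ν.rowLen i : ℤ) - ((i : ℤ) + 1) := rfl
  have : (Finset.range (i - ν.rowLen i)).card ≤ ((Finset.range (numParts μ ν)).filter
      (fun k => shifted ν i < shifted μ k)).card := by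
    apply Finset.card_le_card
    intro j hj
    rw [Finset.mem_range] at hj
    refine Finset.mem_filter.mpr ⟨Finset.mem_range.mpr (by omega), ?_⟩
    unfold shifted
    omega
  rw [Finset.card_range] at this
  unfold rhoPart
  omega

theorem lambda_rowLen (μ ν : YoungDiagram) {i : ℕ} (hi : i < numParts μ ν) :
    ((lambda μ ν).rowLen i : ℤ) = lambdaPart μ ν i := by
  have h := YoungDiagram.rowLen_ofRowLens (hw := sortedGE_map_toNat (lambdaPart_antitone μ ν)
    (numParts μ ν)) ⟨i, by simpa using hi⟩
  have h0 := lambdaPart_nonneg μ ν hi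
  simp only [Fin.getElem_fin, List.getElem_map, List.getElem_range] at h
  unfold lambda
  rw [h]
  omega

theorem rho_rowLen (μ ν : YoungDiagram) {i : ℕ} (hi : i < numParts μ ν) :
    ((rho μ ν).rowLen i : ℤ) = rhoPart μ ν i := by
  have h := YoungDiagram.rowLen_ofRowLens (hw := sortedGE_map_toNat (rhoPart_antitone μ ν)
    (numParts μ ν)) ⟨i, by simpa using hi⟩
  have h0 := rhoPart_nonneg μ ν hi
  simp only [Fin.getElem_fin, List.getElem_map, List.getElem_range] at h
  unfold rho
  rw [h]
  omega

/-! ### Schur functions -/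

/-- The content of a semistandard tableau: `content T m` is the number of entries equal to `m`. -/
noncomputable def content {μ : YoungDiagram} (T : SemistandardYoungTableau μ) : ℕ →₀ ℕ :=
  ∑ c ∈ μ.cells, Finsupp.single (T c.1 c.2) 1

/-- There are finitely many semistandard tableaux of given shape and content, so that the
cardinality in the definition of `schur` is a genuine one. -/
theorem finite_content (μ : YoungDiagram) (m : ℕ →₀ ℕ) :
    Finite {T : SemistandardYoungTableau μ // content T = m} := by
  have key : ∀ T : {T : SemistandardYoungTableau μ // content T = m},
      ∀ c : μ.cells, T.1 c.1.1 c.1.2 ∈ m.support := by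
    rintro ⟨T, rfl⟩ ⟨c, hc⟩
    rw [Finsupp.mem_support_iff]
    unfold content
    rw [Finsupp.finsetSum_apply]
    have := Finset.single_le_sum (f := fun d : ℕ × ℕ =>
      (Finsupp.single (T d.1 d.2) 1 : ℕ →₀ ℕ) (T c.1 c.2)) (fun _ _ => Nat.zero_le _) hc
    simp only [Finsupp.single_eq_same] at this
    simp only
    omega
  refine Finite.of_injective
    (fun T => (fun c => ⟨T.1 c.1.1 c.1.2, key T c⟩ : μ.cells → m.support)) ?_
  intro T T' h
  apply Subtype.ext
  apply SemistandardYoungTableau.ext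
  intro i j
  by_cases hc : (i, j) ∈ μ
  · have := congrFun h ⟨(i, j), hc⟩
    exact congrArg Subtype.val this
  · rw [T.1.zeros hc, T'.1.zeros hc]

/-- The Schur function `s_μ = ∑_T x^T` in the variables `x_0, x_1, …`, the sum being over all
semistandard tableaux `T` of shape `μ`: the coefficient of `x^m` is the number of semistandard
tableaux of shape `μ` and content `m`. Symmetric functions are regarded, as usual, as elements of
the ring of formal power series in countably many variables. -/
noncomputable def schur (μ : YoungDiagram) : MvPowerSeries ℕ ℤ :=
  fun m => (Nat.card {T : SemistandardYoungTableau μ // content T = m} : ℤ)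

/-- `f` is Schur-positive: it is a (finite) linear combination of Schur functions whose coefficients
are nonnegative integers. -/
def IsSchurPositive (f : MvPowerSeries ℕ ℤ) : Prop :=
  ∃ c : YoungDiagram →₀ ℕ, f = c.sum (fun θ k => k • schur θ)

/-- The Fomin–Fulton–Li–Poon conjecture holds for the pair `(μ, ν)`: with `(λ, ρ) = (μ, ν)^*`, the
symmetric function `s_λ s_ρ - s_μ s_ν` is Schur-positive. -/
def ConjectureHolds (μ ν : YoungDiagram) : Prop :=
  IsSchurPositive (schur (lambda μ ν) * schur (rho μ ν) - schur μ * schur ν)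

end FFLP

namespace FFLP

/-! ### Bender–Knuth involutions -/

section Toggle

variable {ν : YoungDiagram}

theorem exists_not_lt_and (T : SemistandardYoungTableau ν) (j v i : ℕ) :
    ∃ c, ¬ (c < j ∧ (i, c) ∈ ν ∧ T i c < v) := ⟨j, by simp⟩

open Classical in
/-- The number of entries less than `v` in the first `j` cells of row `i`. -/
noncomputable def rowCount (T : SemistandardYoungTableau ν) (j v i : ℕ) : ℕ :=
  Nat.find (exists_not_lt_and T j v i)

/-- Rows increase weakly, so the columns satisfying the condition form an initial segment, and its
first failure counts them. -/
theorem lt_rowCount (T : SemistandardYoungTableau ν) (j v i c : ℕ) :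
    c < rowCount T j v i ↔ c < j ∧ (i, c) ∈ ν ∧ T i c < v := by
  classical
  unfold rowCount
  rw [Nat.lt_find_iff]
  constructor
  · intro h
    exact not_not.1 (h c le_rfl)
  · rintro ⟨h1, h2, h3⟩ m hm
    rw [not_not]
    exact ⟨by omega, ν.up_left_mem le_rfl hm h2, (T.row_weak_of_le hm h2).trans_lt h3⟩

theorem rowCount_mono (T : SemistandardYoungTableau ν) (j i : ℕ) {v w : ℕ} (h : v ≤ w) :
    rowCount T j v i ≤ rowCount T j w i := by
  refine le_of_forall_lt fun c hc => ?_
  rw [lt_rowCount] at hc ⊢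
  exact ⟨hc.1, hc.2.1, hc.2.2.trans_le h⟩

theorem rowCount_succ_le (T : SemistandardYoungTableau ν) (j v i : ℕ) :
    rowCount T j (v + 1) (i + 1) ≤ rowCount T j v i := by
  refine le_of_forall_lt fun c hc => ?_
  rw [lt_rowCount] at hc ⊢
  have := T.col_strict (Nat.lt_add_one i) hc.2.1
  exact ⟨hc.1, ν.up_left_mem (Nat.le_succ i) le_rfl hc.2.1, by omega⟩

theorem rowCount_eq_zero (T : SemistandardYoungTableau ν) (j v : ℕ) {i : ℕ}
    (hi : ν.colLen 0 ≤ i) : rowCount T j v i = 0 := by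
  by_contra h
  have := (lt_rowCount T j v i 0).1 (Nat.pos_of_ne_zero h)
  rw [YoungDiagram.mem_iff_lt_colLen] at this
  omega

/-- The largest value that the number of entries at most `k` in the first `j` cells of row `i` can
take when the entries other than `k` and `k + 1` are fixed. -/
noncomputable def toggleMax (T : SemistandardYoungTableau ν) (j k : ℕ) : ℕ → ℕ
  | 0 => rowCount T j (k + 2) 0
  | i + 1 => min (rowCount T j (k + 2) (i + 1)) (rowCount T j k i)

/-- The smallest value that the number of entries at most `k` in the first `j` cells of row `i` can
take when the entries other than `k` and `k + 1` are fixed. -/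
noncomputable def toggleMin (T : SemistandardYoungTableau ν) (j k i : ℕ) : ℕ :=
  max (rowCount T j (k + 2) (i + 1)) (rowCount T j k i)

theorem rowCount_le_toggleMax (T : SemistandardYoungTableau ν) (j k i : ℕ) :
    rowCount T j (k + 1) i ≤ toggleMax T j k i := by
  cases i with
  | zero => exact rowCount_mono T j 0 (by omega)
  | succ i => exact le_min (rowCount_mono T j _ (by omega)) (rowCount_succ_le T j k i)

theorem toggleMin_le_rowCount (T : SemistandardYoungTableau ν) (j k i : ℕ) :
    toggleMin T j k i ≤ rowCount T j (k + 1) i :=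
  max_le (rowCount_succ_le T j (k + 1) i) (rowCount_mono T j _ (by omega))

theorem toggleMax_le (T : SemistandardYoungTableau ν) (j k i : ℕ) :
    toggleMax T j k i ≤ rowCount T j (k + 2) i := by
  cases i with
  | zero => exact le_rfl
  | succ i => exact min_le_left _ _

/-- `toggleMin` in a row and `toggleMax` in the next row are the maximum and minimum of the same two
numbers, so the sum regroups. -/
theorem sum_toggleMax_add_toggleMin (T : SemistandardYoungTableau ν) (j k n : ℕ) :
    ∑ i ∈ Finset.range n, (toggleMax T j k i + toggleMin T j k i) + toggleMax T j k n =
      ∑ i ∈ Finset.range (n + 1), rowCount T j (k + 2) i +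
        ∑ i ∈ Finset.range n, rowCount T j k i := by
  induction n with
  | zero => simp [toggleMax]
  | succ n ih =>
    rw [Finset.sum_range_succ, Finset.sum_range_succ _ (n + 1),
      Finset.sum_range_succ (rowCount T j k)]
    have : toggleMin T j k n + toggleMax T j k (n + 1) =
      rowCount T j (k + 2) (n + 1) + rowCount T j k n := max_add_min _ _
    omega

/-- The number of entries at most `k` in the first `j` cells of row `i` of `toggle T j k`. -/
noncomputable def toggleRow (T : SemistandardYoungTableau ν) (j k i : ℕ) : ℕ :=
  toggleMax T j k i + toggleMin T j k i - rowCount T j (k + 1) i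

/-- `toggleRow` is the reflection of `rowCount T j (k + 1) i` in the interval from `toggleMin` to
`toggleMax`, hence stays in it. -/
theorem toggleRow_le (T : SemistandardYoungTableau ν) (j k i : ℕ) :
    toggleRow T j k i ≤ toggleMax T j k i := by
  have := toggleMin_le_rowCount T j k i
  unfold toggleRow
  omega

theorem le_toggleRow (T : SemistandardYoungTableau ν) (j k i : ℕ) :
    toggleMin T j k i ≤ toggleRow T j k i := by
  have := rowCount_le_toggleMax T j k i
  unfold toggleRow
  omega

/-- The Bender–Knuth involution exchanging the numbers of entries `k` and `k + 1`, applied to the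
first `j` columns of `T`. -/
noncomputable def toggle (T : SemistandardYoungTableau ν) (j k : ℕ)
    (h : ∀ i, (i, j) ∈ ν → T i j ≠ k) : SemistandardYoungTableau ν where
  entry i c := if rowCount T j k i ≤ c ∧ c < rowCount T j (k + 2) i then
    (if c < toggleRow T j k i then k else k + 1) else T i c
  row_weak' := by
    intro i c d hcd hd
    have hT := T.row_weak hcd hd
    have h1 := lt_rowCount T j k i c
    have h2 := lt_rowCount T j (k + 2) i c
    have h3 := lt_rowCount T j k i d
    have h4 := lt_rowCount T j (k + 2) i d
    have hc : (i, c) ∈ ν := ν.up_left_mem le_rfl hcd.le hd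
    simp only [hc, hd, true_and] at h1 h2 h3 h4
    -- Across the cut at column `j`, a toggled entry may be `k + 1`; the absence of `k` in column
    -- `j` keeps the row increasing.
    by_cases hj : j ≤ d
    · have hjν : (i, j) ∈ ν := ν.up_left_mem le_rfl hj hd
      have hj1 := T.row_weak_of_le hj hd
      have hj2 := h i hjν
      by_cases hcj : c ≤ j
      · have hj3 := T.row_weak_of_le hcj hjν
        split_ifs <;> omega
      · split_ifs <;> omega
    · split_ifs <;> omega
  col_strict' := by
    intro a b c hab hb
    have hT := T.col_strict hab hb
    have ha : (a, c) ∈ ν := ν.up_left_mem hab.le le_rfl hb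
    have h1 := lt_rowCount T j k a c
    have h2 := lt_rowCount T j (k + 2) a c
    have h3 := lt_rowCount T j k b c
    have h4 := lt_rowCount T j (k + 2) b c
    simp only [ha, hb, true_and] at h1 h2 h3 h4
    -- Adjacent rows are controlled by the two bounds on `toggleRow`; entries further apart differ
    -- by at least 2, which exchanging `k` and `k + 1` cannot spoil.
    obtain rfl | hab' : b = a + 1 ∨ a + 1 < b := by omega
    · have h5 : rowCount T j (k + 2) (a + 1) ≤ toggleRow T j k a :=
        (le_max_left _ _).trans (le_toggleRow T j k a)
      have h6 : toggleRow T j k (a + 1) ≤ rowCount T j k a :=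
        (toggleRow_le T j k (a + 1)).trans (min_le_right _ _)
      split_ifs <;> omega
    · have h5 := T.col_strict (Nat.lt_add_one a) (ν.up_left_mem hab'.le le_rfl hb)
      have h6 := T.col_strict hab' hb
      split_ifs <;> omega
  zeros' := by
    intro i c hc
    have h2 := lt_rowCount T j (k + 2) i c
    rw [if_neg, T.zeros hc]
    tauto

theorem toggle_apply (T : SemistandardYoungTableau ν) (j k : ℕ)
    (h : ∀ i, (i, j) ∈ ν → T i j ≠ k) (i c : ℕ) :
    toggle T j k h i c = if rowCount T j k i ≤ c ∧ c < rowCount T j (k + 2) i then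
      (if c < toggleRow T j k i then k else k + 1) else T i c := rfl

theorem toggle_apply_of_le (T : SemistandardYoungTableau ν) (j k : ℕ)
    (h : ∀ i, (i, j) ∈ ν → T i j ≠ k) {i c : ℕ} (hc : j ≤ c) :
    toggle T j k h i c = T i c := by
  have h2 := lt_rowCount T j (k + 2) i c
  rw [toggle_apply, if_neg]
  omega

theorem rowCount_toggle (T : SemistandardYoungTableau ν) (j k : ℕ)
    (h : ∀ i, (i, j) ∈ ν → T i j ≠ k) (v i : ℕ) :
    rowCount (toggle T j k h) j v i =
      if v = k + 1 then toggleRow T j k i else rowCount T j v i := by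
  refine eq_of_forall_lt_iff fun c => ?_
  have h1 := lt_rowCount T j k i c
  have h2 := lt_rowCount T j (k + 2) i c
  have h3 := lt_rowCount T j v i c
  have h5 : rowCount T j k i ≤ toggleRow T j k i :=
    (le_max_right _ _).trans (le_toggleRow T j k i)
  have h6 := (toggleRow_le T j k i).trans (toggleMax_le T j k i)
  rw [lt_rowCount, toggle_apply]
  by_cases hcj : c < j
  · by_cases hc : (i, c) ∈ ν
    · simp only [hc, hcj, true_and] at h1 h2 h3 ⊢
      split_ifs <;> omega
    · simp only [hc, hcj, true_and, false_and, iff_false, false_iff, not_lt] at h1 h2 h3 ⊢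
      split_ifs <;> omega
  · simp only [hcj, false_and, iff_false, false_iff, not_lt] at h1 h2 h3 ⊢
    split_ifs <;> omega

/-- The interval of reflection depends only on the counts at `k` and `k + 2`, which toggling
preserves; reflecting twice is the identity. -/
theorem toggleRow_toggle (T : SemistandardYoungTableau ν) (j k : ℕ)
    (h : ∀ i, (i, j) ∈ ν → T i j ≠ k) (i : ℕ) :
    toggleRow (toggle T j k h) j k i = rowCount T j (k + 1) i := by
  have h1 : toggleMax (toggle T j k h) j k i = toggleMax T j k i := by
    cases i <;> simp [toggleMax, rowCount_toggle]
  have h2 : toggleMin (toggle T j k h) j k i = toggleMin T j k i := by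
    simp [toggleMin, rowCount_toggle]
  have h3 := rowCount_le_toggleMax T j k i
  have h4 := toggleMin_le_rowCount T j k i
  rw [toggleRow, h1, h2, rowCount_toggle, if_pos rfl]
  unfold toggleRow
  omega

theorem toggle_toggle (T : SemistandardYoungTableau ν) (j k : ℕ)
    (h : ∀ i, (i, j) ∈ ν → T i j ≠ k)
    (h' : ∀ i, (i, j) ∈ ν → toggle T j k h i j ≠ k) :
    toggle (toggle T j k h) j k h' = T := by
  ext i c
  have h1 := lt_rowCount T j k i c
  have h2 := lt_rowCount T j (k + 1) i c
  have h3 := lt_rowCount T j (k + 2) i c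
  rw [toggle_apply, rowCount_toggle T j k h k, rowCount_toggle T j k h (k + 2), toggleRow_toggle,
    if_neg (show k ≠ k + 1 by omega), if_neg (show k + 2 ≠ k + 1 by omega), toggle_apply]
  split_ifs with h4 h5
  · simp only [(h3.1 h4.2).2.1, true_and] at h1 h2 h3
    omega
  · simp only [(h3.1 h4.2).2.1, true_and] at h1 h2 h3
    omega
  · rfl

/-! ### Contents of the left and right parts of a tableau -/

/-- The number of entries `v` in the first `j` columns. -/
def lowerCount (T : SemistandardYoungTableau ν) (j v : ℕ) : ℕ :=
  (ν.cells.filter fun c => c.2 < j ∧ T c.1 c.2 = v).card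

/-- The number of entries `v` outside the first `j` columns. -/
def upperCount (T : SemistandardYoungTableau ν) (j v : ℕ) : ℕ :=
  (ν.cells.filter fun c => j ≤ c.2 ∧ T c.1 c.2 = v).card

theorem content_apply (T : SemistandardYoungTableau ν) (v : ℕ) :
    content T v = (ν.cells.filter fun c => T c.1 c.2 = v).card := by
  unfold content
  rw [Finsupp.finsetSum_apply, Finset.card_filter]
  simp only [Finsupp.single_apply]

theorem content_eq_lowerCount_add_upperCount (T : SemistandardYoungTableau ν) (j v : ℕ) :
    content T v = lowerCount T j v + upperCount T j v := by
  rw [content_apply, lowerCount, upperCount,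
    ← Finset.card_filter_add_card_filter_not (fun c : ℕ × ℕ => c.2 < j),
    Finset.filter_filter, Finset.filter_filter]
  simp only [not_lt, and_comm]

theorem upperCount_zero (T : SemistandardYoungTableau ν) (v : ℕ) :
    upperCount T 0 v = content T v := by
  simp [content_apply, upperCount]

theorem lowerCount_add_sum (T : SemistandardYoungTableau ν) (j v : ℕ) :
    lowerCount T j v + ∑ i ∈ Finset.range (ν.colLen 0), rowCount T j v i =
      ∑ i ∈ Finset.range (ν.colLen 0), rowCount T j (v + 1) i := by
  have h1 : lowerCount T j v = ∑ i ∈ Finset.range (ν.colLen 0),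
      (rowCount T j (v + 1) i - rowCount T j v i) := by
    unfold lowerCount
    rw [Finset.card_eq_sum_card_fiberwise (f := Prod.fst) (t := Finset.range (ν.colLen 0))]
    · refine Finset.sum_congr rfl fun i _ => ?_
      rw [← Nat.card_Ico]
      refine Finset.card_bij' (fun c _ => c.2) (fun c _ => (i, c)) ?_ ?_ ?_ ?_
      · rintro ⟨a, c⟩ hc
        simp only [Finset.mem_filter, YoungDiagram.mem_cells] at hc
        obtain ⟨⟨hc1, hc2, hc3⟩, rfl⟩ := hc
        rw [Finset.mem_Ico, ← not_lt, lt_rowCount, lt_rowCount]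
        dsimp only
        exact ⟨by omega, hc2, hc1, by omega⟩
      · intro c hc
        rw [Finset.mem_Ico, ← not_lt, lt_rowCount, lt_rowCount] at hc
        obtain ⟨hc1, hc2, hc3, hc4⟩ := hc
        simp only [hc2, hc3, true_and, not_lt] at hc1
        simp only [Finset.mem_filter, YoungDiagram.mem_cells, and_true]
        exact ⟨hc3, hc2, by omega⟩
      · rintro ⟨a, c⟩ hc
        simp only [Finset.mem_filter] at hc
        simp [hc.2]
      · simp
    · rintro ⟨a, c⟩ hc
      simp only [Finset.coe_filter, Set.mem_ofPred_eq, YoungDiagram.mem_cells] at hc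
      have := ν.up_left_mem le_rfl (Nat.zero_le c) hc.1
      rw [YoungDiagram.mem_iff_lt_colLen] at this
      simpa using this
  rw [h1, ← Finset.sum_add_distrib]
  refine Finset.sum_congr rfl fun i _ => ?_
  have := rowCount_mono T j i (Nat.le_add_right v 1)
  omega

theorem sum_toggleRow (T : SemistandardYoungTableau ν) (j k : ℕ) :
    ∑ i ∈ Finset.range (ν.colLen 0), toggleRow T j k i +
        ∑ i ∈ Finset.range (ν.colLen 0), rowCount T j (k + 1) i =
      ∑ i ∈ Finset.range (ν.colLen 0), rowCount T j (k + 2) i +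
        ∑ i ∈ Finset.range (ν.colLen 0), rowCount T j k i := by
  have h1 := sum_toggleMax_add_toggleMin T j k (ν.colLen 0)
  have h2 := toggleMax_le T j k (ν.colLen 0)
  rw [rowCount_eq_zero T j (k + 2) le_rfl] at h2
  rw [Finset.sum_range_succ, rowCount_eq_zero T j (k + 2) le_rfl, add_zero,
    Nat.le_zero.1 h2, add_zero] at h1
  rw [← h1, ← Finset.sum_add_distrib]
  refine Finset.sum_congr rfl fun i _ => ?_
  have h3 := rowCount_le_toggleMax T j k i
  unfold toggleRow
  omega

theorem lowerCount_toggle (T : SemistandardYoungTableau ν) (j k : ℕ)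
    (h : ∀ i, (i, j) ∈ ν → T i j ≠ k) (v : ℕ) :
    lowerCount (toggle T j k h) j v = lowerCount T j (Equiv.swap k (k + 1) v) := by
  have h1 := lowerCount_add_sum (toggle T j k h) j v
  have h2 := sum_toggleRow T j k
  have h3 := lowerCount_add_sum T j k
  have h4 := lowerCount_add_sum T j (k + 1)
  have h5 := lowerCount_add_sum T j v
  simp only [rowCount_toggle] at h1
  obtain rfl | hk := eq_or_ne v k
  · rw [Equiv.swap_apply_left]
    simp only [if_true, Nat.left_eq_add, one_ne_zero, if_false] at h1
    simp only [add_assoc, Nat.reduceAdd] at *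
    omega
  obtain rfl | hk' := eq_or_ne v (k + 1)
  · rw [Equiv.swap_apply_right]
    simp only [if_true, Nat.add_eq_left, one_ne_zero, if_false] at h1
    simp only [add_assoc, Nat.reduceAdd] at *
    omega
  · rw [Equiv.swap_apply_of_ne_of_ne hk hk']
    simp only [hk', if_false, Nat.add_right_cancel_iff, hk] at h1
    omega

theorem upperCount_toggle (T : SemistandardYoungTableau ν) (j k : ℕ)
    (h : ∀ i, (i, j) ∈ ν → T i j ≠ k) {l : ℕ} (hl : j ≤ l) (v : ℕ) :
    upperCount (toggle T j k h) l v = upperCount T l v := by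
  unfold upperCount
  congr 1
  refine Finset.filter_congr fun c _ => and_congr_right fun hc => ?_
  rw [toggle_apply_of_le T j k h (hl.trans hc)]

theorem exists_of_upperCount_pos (T : SemistandardYoungTableau ν) {j v : ℕ}
    (h : 0 < upperCount T j v) : ∃ i c, (i, c) ∈ ν ∧ j ≤ c ∧ T i c = v := by
  obtain ⟨⟨i, c⟩, hc⟩ := Finset.card_pos.1 h
  simp only [Finset.mem_filter, YoungDiagram.mem_cells] at hc
  exact ⟨i, c, hc⟩

theorem upperCount_pos (T : SemistandardYoungTableau ν) {i c j : ℕ} (hc : (i, c) ∈ ν)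
    (hj : j ≤ c) : 0 < upperCount T j (T i c) :=
  Finset.card_pos.2 ⟨(i, c), by simp [hc, hj]⟩

theorem upperCount_eq_zero (T : SemistandardYoungTableau ν) {j : ℕ} (v : ℕ)
    (hj : ν.rowLen 0 ≤ j) : upperCount T j v = 0 := by
  by_contra h
  obtain ⟨i, c, hc, hjc, -⟩ := exists_of_upperCount_pos T (Nat.pos_of_ne_zero h)
  rw [YoungDiagram.mem_iff_lt_rowLen] at hc
  have := ν.rowLen_anti 0 i (Nat.zero_le i)
  omega

theorem upperCount_succ_le (T : SemistandardYoungTableau ν) (j v : ℕ) :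
    upperCount T (j + 1) v ≤ upperCount T j v := by
  refine Finset.card_le_card fun c => ?_
  simp only [Finset.mem_filter]
  exact fun hc => ⟨hc.1, by omega, hc.2.2⟩

theorem eq_of_apply_eq (T : SemistandardYoungTableau ν) {i i' c : ℕ} (h : (i, c) ∈ ν)
    (h' : (i', c) ∈ ν) (he : T i c = T i' c) : i = i' := by
  rcases lt_trichotomy i i' with hlt | rfl | hlt
  · exact absurd he (T.col_strict hlt h').ne
  · rfl
  · exact absurd he (T.col_strict hlt h).ne'

theorem upperCount_le_succ (T : SemistandardYoungTableau ν) (j v : ℕ) :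
    upperCount T j v ≤ upperCount T (j + 1) v + 1 := by
  have h : upperCount T j v ≤ upperCount T (j + 1) v +
      (ν.cells.filter fun c => c.2 = j ∧ T c.1 c.2 = v).card := by
    refine le_trans (Finset.card_le_card ?_) (Finset.card_union_le _ _)
    intro c
    simp only [Finset.mem_filter, Finset.mem_union]
    grind
  refine h.trans (Nat.add_le_add_left ?_ _)
  rw [Finset.card_le_one]
  rintro ⟨a, c⟩ hc ⟨a', c'⟩ hc'
  simp only [Finset.mem_filter, YoungDiagram.mem_cells] at hc hc'
  obtain ⟨h1, rfl, h2⟩ := hc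
  obtain ⟨h3, rfl, h4⟩ := hc'
  rw [eq_of_apply_eq T h1 h3 (h2.trans h4.symm)]

theorem upperCount_lt_of_mem (T : SemistandardYoungTableau ν) {i j : ℕ} (h : (i, j) ∈ ν) :
    upperCount T (j + 1) (T i j) < upperCount T j (T i j) := by
  refine Finset.card_lt_card (Finset.ssubset_iff_of_subset ?_ |>.2 ⟨(i, j), ?_, ?_⟩)
  · intro c
    simp only [Finset.mem_filter]
    exact fun hc => ⟨hc.1, by omega, hc.2.2⟩
  · simp [h]
  · simp

/-- Column strictness allows each value once per column. This bound makes dominance across a large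
gap automatic. -/
theorem upperCount_le_rowLen (T : SemistandardYoungTableau ν) (j v : ℕ) :
    upperCount T j v ≤ ν.rowLen 0 := by
  rw [← Finset.card_range (ν.rowLen 0)]
  refine Finset.card_le_card_of_injOn Prod.snd ?_ ?_
  · rintro ⟨i, c⟩ hc
    simp only [Finset.coe_filter, Set.mem_ofPred_eq, YoungDiagram.mem_cells,
      YoungDiagram.mem_iff_lt_rowLen] at hc
    have := ν.rowLen_anti 0 i (Nat.zero_le i)
    simp only [Finset.coe_range, Set.mem_Iio]
    omega
  · rintro ⟨i, c⟩ hc ⟨i', c'⟩ hc' (rfl : c = c')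
    simp only [Finset.coe_filter, Set.mem_ofPred_eq, YoungDiagram.mem_cells] at hc hc'
    rw [eq_of_apply_eq T hc.1 hc'.1 (hc.2.2.trans hc'.2.2.symm)]

end Toggle

/-! ### Tableaux that stay dominant -/

section Good

variable {ν : YoungDiagram}

/-- Adding to the sequence `f` the content of the part of `T` formed by the columns from the `j`-th
one on gives a weakly decreasing sequence, for every `j`. -/
def IsGood (f : ℕ → ℕ) (T : SemistandardYoungTableau ν) : Prop :=
  ∀ j k, f (k + 1) + upperCount T j (k + 1) ≤ f k + upperCount T j k

/-- `j` is the last column at which `T` fails to be good, and `k` the first index at which it fails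
there. -/
def IsPivot (f : ℕ → ℕ) (T : SemistandardYoungTableau ν) (j k : ℕ) : Prop :=
  f k + upperCount T j k < f (k + 1) + upperCount T j (k + 1) ∧
    (∀ l, j < l → ∀ m, f (m + 1) + upperCount T l (m + 1) ≤ f m + upperCount T l m) ∧
    ∀ m < k, f (m + 1) + upperCount T j (m + 1) ≤ f m + upperCount T j m

/-- Beyond the last column the counts vanish and `f` itself is decreasing, so the failing columns
are bounded and a last one exists. -/
theorem exists_isPivot {f : ℕ → ℕ} (hf : Antitone f) {T : SemistandardYoungTableau ν}
    (hT : ¬ IsGood f T) : ∃ j k, IsPivot f T j k := by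
  classical
  let P : ℕ → Prop := fun j => ∃ k, f k + upperCount T j k < f (k + 1) + upperCount T j (k + 1)
  have hP : ∀ j, P j → j ≤ ν.rowLen 0 := by
    rintro j ⟨k, hk⟩
    by_contra hj
    rw [upperCount_eq_zero T _ (by omega), upperCount_eq_zero T _ (by omega)] at hk
    have := hf (Nat.le_add_right k 1)
    omega
  unfold IsGood at hT
  push Not at hT
  obtain ⟨j, hj⟩ := hT
  have hm : P (Nat.findGreatest P (ν.rowLen 0)) := Nat.findGreatest_spec (hP j hj) hj
  refine ⟨Nat.findGreatest P (ν.rowLen 0), Nat.find hm, Nat.find_spec hm, ?_, ?_⟩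
  · intro l hl m
    by_contra hlm
    rw [not_le] at hlm
    exact Nat.findGreatest_is_greatest hl (hP l ⟨m, hlm⟩) ⟨m, hlm⟩
  · intro m hmk
    exact not_lt.1 (Nat.find_min hm hmk)

theorem IsPivot.unique {f : ℕ → ℕ} {T : SemistandardYoungTableau ν} {j k j' k' : ℕ}
    (h : IsPivot f T j k) (h' : IsPivot f T j' k') : j = j' ∧ k = k' := by
  obtain rfl : j = j' := by
    rcases lt_trichotomy j j' with hlt | rfl | hlt
    · exact absurd h'.1 (not_lt.2 (h.2.1 _ hlt _))
    · rfl
    · exact absurd h.1 (not_lt.2 (h'.2.1 _ hlt _))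
  refine ⟨rfl, ?_⟩
  rcases lt_trichotomy k k' with hlt | rfl | hlt
  · exact absurd h.1 (not_lt.2 (h'.2.2 _ hlt))
  · rfl
  · exact absurd h'.1 (not_lt.2 (h.2.2 _ hlt))

/-- There is no failure at column `j + 1`, and one column changes each count by at most 1. So the
failure is by exactly 1, and column `j` contains no `k`, as `toggle` requires. -/
theorem IsPivot.eq {f : ℕ → ℕ} {T : SemistandardYoungTableau ν} {j k : ℕ}
    (h : IsPivot f T j k) :
    f k + upperCount T j k + 1 = f (k + 1) + upperCount T j (k + 1) ∧
      upperCount T (j + 1) k = upperCount T j k ∧ 0 < upperCount T j (k + 1) := by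
  have h1 := h.1
  have h2 := h.2.1 (j + 1) (Nat.lt_add_one j) k
  have h3 := upperCount_succ_le T j k
  have h4 := upperCount_le_succ T j (k + 1)
  omega

theorem IsPivot.ne {f : ℕ → ℕ} {T : SemistandardYoungTableau ν} {j k : ℕ}
    (h : IsPivot f T j k) (i : ℕ) (hi : (i, j) ∈ ν) : T i j ≠ k := by
  rintro rfl
  exact absurd h.eq.2.1 (upperCount_lt_of_mem T hi).ne

/-- The pivot is read off from columns that toggling leaves alone; hence toggling at the pivot is an
involution on bad tableaux. -/
theorem IsPivot.toggle {f : ℕ → ℕ} {T : SemistandardYoungTableau ν} {j k : ℕ}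
    (h : IsPivot f T j k) : IsPivot f (toggle T j k h.ne) j k := by
  refine ⟨?_, fun l hl m => ?_, fun m hm => ?_⟩
  · rw [upperCount_toggle _ _ _ _ le_rfl, upperCount_toggle _ _ _ _ le_rfl]
    exact h.1
  · rw [upperCount_toggle _ _ _ _ hl.le, upperCount_toggle _ _ _ _ hl.le]
    exact h.2.1 l hl m
  · rw [upperCount_toggle _ _ _ _ le_rfl, upperCount_toggle _ _ _ _ le_rfl]
    exact h.2.2 m hm

theorem IsPivot.not_isGood {f : ℕ → ℕ} {T : SemistandardYoungTableau ν} {j k : ℕ}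
    (h : IsPivot f T j k) : ¬ IsGood f T :=
  fun hT => absurd h.1 (not_lt.2 (hT j k))

theorem content_toggle (T : SemistandardYoungTableau ν) (j k : ℕ)
    (h : ∀ i, (i, j) ∈ ν → T i j ≠ k) (v : ℕ) :
    content (toggle T j k h) v = lowerCount T j (Equiv.swap k (k + 1) v) + upperCount T j v := by
  rw [content_eq_lowerCount_add_upperCount _ j, lowerCount_toggle,
    upperCount_toggle _ _ _ _ le_rfl]

theorem isGood_zero_iff (T : SemistandardYoungTableau ν) :
    IsGood 0 T ↔ T = SemistandardYoungTableau.highestWeight ν := by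
  have hge : ∀ T : SemistandardYoungTableau ν, ∀ i c, (i, c) ∈ ν → i ≤ T i c := by
    intro T i
    induction i with
    | zero => simp
    | succ i ih =>
      intro c hc
      have h1 := T.col_strict (Nat.lt_add_one i) hc
      have h2 := ih c (ν.up_left_mem (Nat.le_add_right i 1) le_rfl hc)
      omega
  constructor
  · intro h
    -- Induction on columns from the right, and on rows from the top within a column. An entry `m +
    -- 1 > i` needs an `m` weakly to its right, and the cells already settled leave no place for it.
    have key : ∀ d i c, (i, c) ∈ ν → ν.rowLen 0 ≤ c + d → T i c = i := by
      intro d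
      induction d with
      | zero =>
        intro i c hc hd
        rw [YoungDiagram.mem_iff_lt_rowLen] at hc
        have := ν.rowLen_anti 0 i (Nat.zero_le i)
        omega
      | succ d ih =>
        intro i
        induction i using Nat.strong_induction_on with
        | _ i ih' =>
        intro c hc hd
        by_contra hne
        have hlt : i < T i c := lt_of_le_of_ne (hge T i c hc) (Ne.symm hne)
        obtain ⟨m, hm⟩ : ∃ m, T i c = m + 1 := ⟨T i c - 1, by omega⟩
        have h1 := h c m
        have h2 := upperCount_pos T hc le_rfl
        rw [hm] at h2
        simp only [Pi.zero_apply, zero_add] at h1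
        obtain ⟨a, e, hae, hce, hT⟩ := exists_of_upperCount_pos T (h2.trans_le h1)
        obtain rfl | hce' := hce.eq_or_lt
        · have hai : a < i := by
            by_contra hai
            have := T.col_weak (not_lt.1 hai) hae
            omega
          have := ih' a hai c hae hd
          omega
        · have h3 := ih a e hae (by omega)
          have h4 : (i, e) ∈ ν := ν.up_left_mem (by omega) le_rfl hae
          have h5 := ih i e h4 (by omega)
          have h6 := T.row_weak hce' h4
          omega
    ext i c
    rw [SemistandardYoungTableau.highestWeight_apply]
    split_ifs with hc
    · exact key (ν.rowLen 0) i c hc (by omega)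
    · exact T.zeros hc
  · rintro rfl j k
    simp only [Pi.zero_apply, zero_add, upperCount]
    -- All entries `k + 1` lie in row `k + 1`; each moves up to the cell above it.
    refine Finset.card_le_card_of_injOn (fun c => (k, c.2)) ?_ ?_
    · rintro ⟨i, c⟩ hc
      simp only [Finset.coe_filter, Set.mem_ofPred_eq, YoungDiagram.mem_cells] at hc ⊢
      simp only [SemistandardYoungTableau.highestWeight_apply] at hc ⊢
      obtain ⟨h1, h2, h3⟩ := hc
      rw [if_pos h1] at h3
      have : (k, c) ∈ ν := ν.up_left_mem (by omega) le_rfl h1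
      simp [this, h2]
    · rintro ⟨i, c⟩ hc ⟨i', c'⟩ hc' he
      simp only [Finset.coe_filter, Set.mem_ofPred_eq, YoungDiagram.mem_cells] at hc hc'
      simp only [SemistandardYoungTableau.highestWeight_apply] at hc hc'
      rw [if_pos hc.1] at hc
      rw [if_pos hc'.1] at hc'
      simp only [Prod.mk.injEq, true_and] at he
      simp only [Prod.mk.injEq]
      omega

theorem content_highestWeight (v : ℕ) :
    content (SemistandardYoungTableau.highestWeight ν) v = ν.rowLen v := by
  rw [content_apply, ← Finset.card_range (ν.rowLen v)]
  refine Finset.card_bij' (fun c _ => c.2) (fun c _ => (v, c)) ?_ ?_ ?_ ?_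
  · rintro ⟨i, c⟩ hc
    simp only [Finset.mem_filter, YoungDiagram.mem_cells] at hc
    simp only [SemistandardYoungTableau.highestWeight_apply] at hc
    rw [if_pos hc.1] at hc
    obtain ⟨hc, rfl⟩ := hc
    simpa [YoungDiagram.mem_iff_lt_rowLen] using hc
  · intro c hc
    rw [Finset.mem_range, ← YoungDiagram.mem_iff_lt_rowLen] at hc
    simp [hc]
  · rintro ⟨i, c⟩ hc
    simp only [Finset.mem_filter, YoungDiagram.mem_cells] at hc
    simp only [SemistandardYoungTableau.highestWeight_apply] at hc
    rw [if_pos hc.1] at hc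
    simp [hc.2]
  · simp

end Good

/-! ### Young diagrams from their rows -/

/-- The parts of a Young diagram, as a finitely supported function. -/
noncomputable def rows (μ : YoungDiagram) : ℕ →₀ ℕ :=
  Finsupp.onFinset (Finset.range (μ.colLen 0)) μ.rowLen (by
    intro i hi
    rw [Finset.mem_range, ← YoungDiagram.mem_iff_lt_colLen, YoungDiagram.mem_iff_lt_rowLen]
    exact Nat.pos_of_ne_zero hi)

theorem rowLen_eq_zero_iff (μ : YoungDiagram) (i : ℕ) : μ.rowLen i = 0 ↔ μ.colLen 0 ≤ i := by
  rw [← not_iff_not, ← ne_eq, ← Nat.pos_iff_ne_zero, ← YoungDiagram.mem_iff_lt_rowLen,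
    YoungDiagram.mem_iff_lt_colLen, not_le]

theorem ext_rowLen {μ ν : YoungDiagram} (h : ∀ i, μ.rowLen i = ν.rowLen i) : μ = ν := by
  ext ⟨i, c⟩
  rw [YoungDiagram.mem_cells, YoungDiagram.mem_cells, YoungDiagram.mem_iff_lt_rowLen,
    YoungDiagram.mem_iff_lt_rowLen, h]

/-- The largest Young diagram whose `i`-th row has length at most `f i`, for all `i`. -/
noncomputable def ofRows (f : ℕ →₀ ℕ) : YoungDiagram where
  cells := (f.support ×ˢ Finset.range (f 0)).filter fun c => ∀ i ≤ c.1, c.2 < f i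
  isLowerSet := by
    rintro ⟨i, c⟩ ⟨i', c'⟩ ⟨hi, hc⟩ h
    simp only [Finset.coe_filter, Finset.mem_product, Finsupp.mem_support_iff, Finset.mem_range,
      Set.mem_ofPred_eq] at h hi hc ⊢
    have h' : ∀ a ≤ i', c' < f a := fun a ha => hc.trans_lt (h.2 a (ha.trans hi))
    exact ⟨⟨(Nat.zero_le _).trans_lt (h' i' le_rfl) |>.ne', h' 0 (Nat.zero_le _)⟩, h'⟩

theorem mem_ofRows {f : ℕ →₀ ℕ} {i c : ℕ} : (i, c) ∈ ofRows f ↔ ∀ a ≤ i, c < f a := by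
  rw [← YoungDiagram.mem_cells]
  simp only [ofRows, Finset.mem_filter, Finset.mem_product, Finsupp.mem_support_iff,
    Finset.mem_range, and_iff_right_iff_imp]
  exact fun h => ⟨(Nat.zero_le _).trans_lt (h i le_rfl) |>.ne', h 0 (Nat.zero_le _)⟩

theorem rowLen_ofRows {f : ℕ →₀ ℕ} (hf : Antitone f) (i : ℕ) : (ofRows f).rowLen i = f i := by
  refine eq_of_forall_lt_iff fun c => ?_
  rw [← YoungDiagram.mem_iff_lt_rowLen, mem_ofRows]
  exact ⟨fun h => h i le_rfl, fun h a ha => h.trans_le (hf ha)⟩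

/-- The Young diagram obtained by adding the content of `T` to the parts of `μ`. -/
noncomputable def addContent {ν : YoungDiagram} (μ : YoungDiagram)
    (T : SemistandardYoungTableau ν) : YoungDiagram :=
  ofRows (rows μ + content T)

theorem rowLen_addContent {μ ν : YoungDiagram} {T : SemistandardYoungTableau ν}
    (h : IsGood μ.rowLen T) (i : ℕ) :
    (addContent μ T).rowLen i = μ.rowLen i + content T i := by
  refine rowLen_ofRows (antitone_nat_of_succ_le fun k => ?_) i
  have := h 0 k
  rwa [upperCount_zero, upperCount_zero] at this

/-! ### Schur polynomials and alternants -/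

/-- The semistandard tableaux of shape `ν` with entries less than `N`. -/
abbrev BoundedTableau (N : ℕ) (ν : YoungDiagram) : Type :=
  {T : SemistandardYoungTableau ν // ∀ i c, (i, c) ∈ ν → T i c < N}

instance (N : ℕ) (ν : YoungDiagram) : Finite (BoundedTableau N ν) := by
  refine Finite.of_injective
    (fun T => (fun c => ⟨T.1 c.1.1 c.1.2, T.2 _ _ c.2⟩ : ν.cells → Fin N)) ?_
  intro T T' h
  apply Subtype.ext
  ext i c
  by_cases hc : (i, c) ∈ ν
  · exact congrArg Fin.val (congrFun h ⟨(i, c), hc⟩)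
  · rw [T.1.zeros hc, T'.1.zeros hc]

noncomputable instance (N : ℕ) (ν : YoungDiagram) : Fintype (BoundedTableau N ν) :=
  Fintype.ofFinite _

section Finite

variable {R : Type*} [CommRing R] {N : ℕ} {ν : YoungDiagram}

theorem content_eq_zero_of_le (T : BoundedTableau N ν) {v : ℕ} (hv : N ≤ v) :
    content T.1 v = 0 := by
  by_contra h
  rw [← upperCount_zero] at h
  obtain ⟨i, c, hc, -, hT⟩ := exists_of_upperCount_pos T.1 (Nat.pos_of_ne_zero h)
  have := T.2 i c hc
  omega

theorem toggle_lt (T : BoundedTableau N ν) (j : ℕ) {k : ℕ} (hk : k + 1 < N)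
    (h : ∀ i, (i, j) ∈ ν → T.1 i j ≠ k) (i c : ℕ) (hc : (i, c) ∈ ν) :
    toggle T.1 j k h i c < N := by
  have := T.2 i c hc
  rw [toggle_apply]
  split_ifs <;> omega

/-- The Schur polynomial of shape `ν` in the variables `x 0, …, x (N - 1)`. -/
noncomputable def schurEval (x : Fin N → R) (ν : YoungDiagram) : R :=
  ∑ T : BoundedTableau N ν, ∏ i : Fin N, x i ^ content T.1 i

theorem schurEval_swap (x : Fin N → R) (ν : YoungDiagram) {k : ℕ} (hk : k + 1 < N) :
    schurEval (x ∘ Equiv.swap (⟨k, by omega⟩ : Fin N) ⟨k + 1, hk⟩) ν = schurEval x ν := by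
  -- Column `ν.rowLen 0` is empty, so toggling there acts on the whole tableau and its hypothesis is
  -- vacuous.
  have h : ∀ T : BoundedTableau N ν, ∀ i, (i, ν.rowLen 0) ∈ ν → T.1 i (ν.rowLen 0) ≠ k := by
    intro T i hi
    rw [YoungDiagram.mem_iff_lt_rowLen] at hi
    exact absurd (ν.rowLen_anti 0 i (Nat.zero_le i)) (not_le.2 hi)
  let e : BoundedTableau N ν → BoundedTableau N ν := fun T =>
    ⟨toggle T.1 (ν.rowLen 0) k (h T), toggle_lt T _ hk (h T)⟩
  have he : Function.Involutive e := fun T =>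
    Subtype.ext (toggle_toggle T.1 (ν.rowLen 0) k (h T) (h (e T)))
  unfold schurEval
  refine Fintype.sum_equiv he.toPerm _ _ fun T => ?_
  refine Fintype.prod_equiv (Equiv.swap (⟨k, by omega⟩ : Fin N) ⟨k + 1, hk⟩) _ _ fun i => ?_
  have h1 : content (e T).1 (Equiv.swap (⟨k, by omega⟩ : Fin N) ⟨k + 1, hk⟩ i : Fin N) =
      content T.1 i := by
    rw [content_toggle, upperCount_eq_zero _ _ le_rfl,
      content_eq_lowerCount_add_upperCount T.1 (ν.rowLen 0), upperCount_eq_zero _ _ le_rfl]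
    congr 2
    simp only [Equiv.swap_apply_def, Fin.ext_iff]
    split_ifs <;> simp_all
  simp only [Function.comp_apply, Function.Involutive.coe_toPerm, h1]

theorem schurEval_perm (x : Fin N → R) (ν : YoungDiagram) (σ : Equiv.Perm (Fin N)) :
    schurEval (x ∘ σ) ν = schurEval x ν := by
  cases N with
  | zero => rw [Subsingleton.elim (x ∘ σ) x]
  | succ n =>
    have hσ : σ ∈ Submonoid.closure
        (Set.range fun i : Fin n => Equiv.swap i.castSucc i.succ) := by
      rw [Equiv.Perm.mclosure_swap_castSucc_succ]
      trivial
    induction hσ using Submonoid.closure_induction generalizing x with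
    | mem σ h =>
      obtain ⟨i, rfl⟩ := h
      exact schurEval_swap x ν (k := i) (by omega)
    | one => rfl
    | mul σ τ _ _ h1 h2 => exact (h2 (x ∘ σ)).trans (h1 x)

/-- The alternant `det (x_i ^ β_j)`. -/
noncomputable def alternant (x : Fin N → R) (β : Fin N → ℕ) : R :=
  (Matrix.of fun i j => x i ^ β j).det

theorem alternant_eq_sum (x : Fin N → R) (β : Fin N → ℕ) :
    alternant x β = ∑ σ : Equiv.Perm (Fin N), Equiv.Perm.sign σ • ∏ i, x (σ i) ^ β i :=
  Matrix.det_apply _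

theorem alternant_comp_swap (x : Fin N → R) (β : Fin N → ℕ) {i j : Fin N} (h : i ≠ j) :
    alternant x (β ∘ Equiv.swap i j) = - alternant x β := by
  have := Matrix.det_permute' (Equiv.swap i j) (Matrix.of fun i j => x i ^ β j)
  rw [Equiv.Perm.sign_swap h] at this
  simpa [alternant, Matrix.submatrix] using this

theorem alternant_eq_zero (x : Fin N → R) (β : Fin N → ℕ) {i j : Fin N} (h : i ≠ j)
    (hβ : β i = β j) : alternant x β = 0 :=
  Matrix.det_zero_of_column_eq h fun a => by simp [hβ]

/-- By symmetry, the Schur polynomial may be expanded in the variables permuted by `σ` inside the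
`σ`-term of the determinant, where exponents simply add. -/
theorem alternant_mul_schurEval (x : Fin N → R) (β : Fin N → ℕ) (ν : YoungDiagram) :
    alternant x β * schurEval x ν =
      ∑ T : BoundedTableau N ν, alternant x (fun i => β i + content T.1 i) := by
  simp only [alternant_eq_sum]
  rw [Finset.sum_comm, Finset.sum_mul]
  refine Finset.sum_congr rfl fun σ _ => ?_
  rw [← schurEval_perm x ν σ, schurEval, Finset.mul_sum]
  refine Finset.sum_congr rfl fun T _ => ?_
  simp only [Function.comp_apply, pow_add, Finset.prod_mul_distrib, smul_mul_assoc]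

-- At a pivot the failure by 1 is compensated by the staircase: the exponents at `k` and `k + 1`,
-- without the toggled columns, agree. Toggling thus transposes two exponents and reverses the sign,
-- and a fixed tableau has two equal exponents and contributes 0.
open Classical in
theorem alternant_mul_schurEval_eq_sum_good (x : Fin N → R) {f : ℕ → ℕ} (hf : Antitone f)
    (ν : YoungDiagram) :
    alternant x (fun i => f i + (N - 1 - i)) * schurEval x ν =
      ∑ T : BoundedTableau N ν with IsGood f T.1,
        alternant x (fun i => f i + (N - 1 - i) + content T.1 i) := by
  rw [alternant_mul_schurEval, ← Finset.sum_filter_add_sum_filter_not _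
    (fun T : BoundedTableau N ν => IsGood f T.1), add_eq_left]
  have hbad : ∀ T ∈ (Finset.univ : Finset (BoundedTableau N ν)).filter
      (fun T => ¬ IsGood f T.1), ∃ j k, IsPivot f T.1 j k :=
    fun T hT => exists_isPivot hf (Finset.mem_filter.1 hT).2
  choose! J K hJK using hbad
  have hK : ∀ (T : BoundedTableau N ν) {j k : ℕ}, IsPivot f T.1 j k → k + 1 < N := by
    intro T j k h
    obtain ⟨i, c, hc, -, hT⟩ := exists_of_upperCount_pos T.1 h.eq.2.2
    exact hT ▸ T.2 i c hc
  let g : ∀ T ∈ (Finset.univ : Finset (BoundedTableau N ν)).filter (fun T => ¬ IsGood f T.1),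
      BoundedTableau N ν := fun T hT =>
    ⟨toggle T.1 (J T) (K T) (hJK T hT).ne, toggle_lt T _ (hK T (hJK T hT)) _⟩
  have hg : ∀ T hT, IsPivot f (g T hT).1 (J T) (K T) := fun T hT => (hJK T hT).toggle
  have hmem : ∀ T hT, g T hT ∈ (Finset.univ : Finset (BoundedTableau N ν)).filter
      (fun T => ¬ IsGood f T.1) :=
    fun T hT => Finset.mem_filter.2 ⟨Finset.mem_univ _, (hg T hT).not_isGood⟩
  have hβ : ∀ T hT, (fun i : Fin N => f i + (N - 1 - i) + content (g T hT).1 i) =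
      (fun i : Fin N => f i + (N - 1 - i) + content T.1 i) ∘
        Equiv.swap (⟨K T, by have := hK T (hJK T hT); omega⟩ : Fin N)
          ⟨K T + 1, hK T (hJK T hT)⟩ := by
    intro T hT
    have h1 := hK T (hJK T hT)
    have h2 := (hJK T hT).eq.1
    funext i
    simp only [Function.comp_apply, g]
    rw [content_toggle, content_eq_lowerCount_add_upperCount T.1 (J T)]
    obtain rfl | hi := eq_or_ne i (⟨K T, by omega⟩ : Fin N)
    · simp only [Equiv.swap_apply_left]
      omega
    obtain rfl | hi' := eq_or_ne i (⟨K T + 1, h1⟩ : Fin N)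
    · simp only [Equiv.swap_apply_right]
      omega
    · rw [Equiv.swap_apply_of_ne_of_ne hi hi', Equiv.swap_apply_of_ne_of_ne]
      · simpa [Fin.ext_iff] using hi
      · simpa [Fin.ext_iff] using hi'
  have hne : ∀ T hT, (⟨K T, by have := hK T (hJK T hT); omega⟩ : Fin N) ≠
      ⟨K T + 1, hK T (hJK T hT)⟩ := fun T hT => by simp [Fin.ext_iff]
  refine Finset.sum_involution g ?_ ?_ hmem ?_
  · intro T hT
    rw [hβ T hT, alternant_comp_swap _ _ (hne T hT), add_neg_cancel]
  · intro T hT h0 he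
    refine h0 (alternant_eq_zero x _ (hne T hT) ?_)
    have := congrFun (hβ T hT) ⟨K T, by have := hK T (hJK T hT); omega⟩
    rw [he] at this
    simpa only [Function.comp_apply, Equiv.swap_apply_left] using this
  · intro T hT
    obtain ⟨h1, h2⟩ := (hJK _ (hmem T hT)).unique (hg T hT)
    apply Subtype.ext
    have h3 : ∀ j k (h : ∀ i, (i, j) ∈ ν → (g T hT).1 i j ≠ k), j = J T → k = K T →
        toggle (g T hT).1 j k h = T.1 := by
      rintro j k h rfl rfl
      exact toggle_toggle T.1 _ _ (hJK T hT).ne _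
    exact h3 _ _ (hJK _ (hmem T hT)).ne h1 h2

/-- The bialternant formula: for `f = 0` only the highest weight tableau survives the cancellation.
-/
theorem alternant_mul_schurEval_eq (x : Fin N → R) (hν : ν.colLen 0 ≤ N) :
    alternant x (fun i => N - 1 - i) * schurEval x ν =
      alternant x (fun i => ν.rowLen i + (N - 1 - i)) := by
  classical
  have h := alternant_mul_schurEval_eq_sum_good x (f := 0) (fun _ _ _ => le_rfl) ν
  simp only [Pi.zero_apply, zero_add] at h
  have hb : ∀ i c, (i, c) ∈ ν → SemistandardYoungTableau.highestWeight ν i c < N := by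
    intro i c hc
    rw [SemistandardYoungTableau.highestWeight_apply, if_pos hc]
    have := ν.up_left_mem le_rfl (Nat.zero_le c) hc
    rw [YoungDiagram.mem_iff_lt_colLen] at this
    omega
  rw [h, Finset.sum_eq_single ⟨SemistandardYoungTableau.highestWeight ν, hb⟩]
  · simp only [content_highestWeight, add_comm]
  · intro T hT hne
    refine absurd (Subtype.ext ?_) hne
    exact (isGood_zero_iff T.1).1 (Finset.mem_filter.1 hT).2
  · intro hT
    refine absurd ?_ hT
    simp [isGood_zero_iff]

open Classical in
theorem alternant_mul_schurEval_mul_schurEval (x : Fin N → R) {μ : YoungDiagram}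
    (hμ : μ.colLen 0 ≤ N) (ν : YoungDiagram) :
    alternant x (fun i => N - 1 - i) * (schurEval x μ * schurEval x ν) =
      alternant x (fun i => N - 1 - i) *
        ∑ T : BoundedTableau N ν with IsGood μ.rowLen T.1, schurEval x (addContent μ T.1) := by
  rw [← mul_assoc, alternant_mul_schurEval_eq x hμ,
    alternant_mul_schurEval_eq_sum_good x (fun i j => μ.rowLen_anti i j), Finset.mul_sum]
  refine Finset.sum_congr rfl fun T hT => ?_
  have hT' := (Finset.mem_filter.1 hT).2
  rw [alternant_mul_schurEval_eq]
  · simp only [rowLen_addContent hT']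
    congr 1
    funext i
    omega
  · rw [← rowLen_eq_zero_iff, rowLen_addContent hT', content_eq_zero_of_le T le_rfl, add_zero,
      rowLen_eq_zero_iff]
    exact hμ

end Finite

/-! ### Schur functions as limits of Schur polynomials -/

section Coefficients

open MvPowerSeries

variable {N : ℕ}

/-- The first `N` variables. -/
noncomputable def vars (N : ℕ) (i : Fin N) : MvPowerSeries ℕ ℤ := X (i : ℕ)

/-- An exponent of the first `N` variables, as an exponent of all the variables. -/
noncomputable def extendExponent (β : Fin N → ℕ) : ℕ →₀ ℕ :=
  ∑ i : Fin N, Finsupp.single (i : ℕ) (β i)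

theorem extendExponent_apply (β : Fin N → ℕ) (i : Fin N) : extendExponent β i = β i := by
  simp [extendExponent, Finsupp.finsetSum_apply, Finsupp.single_apply, Fin.val_inj]

theorem extendExponent_apply_of_le (β : Fin N → ℕ) {i : ℕ} (hi : N ≤ i) :
    extendExponent β i = 0 := by
  rw [extendExponent, Finsupp.finsetSum_apply]
  refine Finset.sum_eq_zero fun a _ => ?_
  rw [Finsupp.single_apply, if_neg]
  omega

theorem eq_extendExponent {m : ℕ →₀ ℕ} (hm : ∀ i, N ≤ i → m i = 0) :
    m = extendExponent fun i : Fin N => m i := by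
  ext i
  by_cases hi : i < N
  · exact (extendExponent_apply (fun i : Fin N => m i) ⟨i, hi⟩).symm
  · rw [hm i (not_lt.1 hi), extendExponent_apply_of_le _ (not_lt.1 hi)]

theorem prod_vars_pow (β : Fin N → ℕ) :
    ∏ i, vars N i ^ β i = monomial (extendExponent β) 1 := by
  simp only [vars, X_pow_eq, prod_monomial, Finset.prod_const_one, extendExponent]

/-- A tableau whose content is supported below `N` has all its entries below `N`. -/
theorem coeff_schurEval_vars (ν : YoungDiagram) {m : ℕ →₀ ℕ} (hm : ∀ i, N ≤ i → m i = 0) :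
    coeff m (schurEval (vars N) ν) = coeff m (schur ν) := by
  classical
  have h1 : ∀ T : BoundedTableau N ν, ∏ i : Fin N, vars N i ^ content T.1 i =
      monomial (content T.1) 1 := fun T => by
    rw [prod_vars_pow, ← eq_extendExponent fun i hi => content_eq_zero_of_le T hi]
  have h2 : coeff m (schur ν) =
      (Nat.card {T : SemistandardYoungTableau ν // content T = m} : ℤ) := rfl
  let e : {T : SemistandardYoungTableau ν // content T = m} ≃
      {T : BoundedTableau N ν // content T.1 = m} :=
    { toFun := fun T => ⟨⟨T.1, fun i c hc => by
          by_contra h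
          have h3 := upperCount_pos T.1 hc (Nat.zero_le c)
          rw [upperCount_zero, T.2, hm _ (not_lt.1 h)] at h3
          exact absurd h3 (lt_irrefl 0)⟩, T.2⟩
      invFun := fun T => ⟨T.1.1, T.2⟩
      left_inv := fun _ => rfl
      right_inv := fun _ => rfl }
  rw [h2, Nat.card_congr e, Nat.card_eq_fintype_card, Fintype.card_subtype, schurEval, map_sum]
  simp only [h1, coeff_monomial, Finset.card_filter, eq_comm (a := m)]
  push_cast
  rfl

theorem coeff_mul_congr {R : Type*} [Semiring R] {f f' g g' : MvPowerSeries ℕ R}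
    (hf : ∀ m : ℕ →₀ ℕ, (∀ i, N ≤ i → m i = 0) → coeff m f = coeff m f')
    (hg : ∀ m : ℕ →₀ ℕ, (∀ i, N ≤ i → m i = 0) → coeff m g = coeff m g')
    {m : ℕ →₀ ℕ} (hm : ∀ i, N ≤ i → m i = 0) : coeff m (f * g) = coeff m (f' * g') := by
  classical
  rw [coeff_mul, coeff_mul]
  refine Finset.sum_congr rfl fun q hq => ?_
  rw [Finset.HasAntidiagonal.mem_antidiagonal] at hq
  have h : ∀ i, N ≤ i → q.1 i = 0 ∧ q.2 i = 0 := by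
    intro i hi
    have := DFunLike.congr_fun hq i
    rw [hm i hi, Finsupp.add_apply] at this
    omega
  rw [hf _ fun i hi => (h i hi).1, hg _ fun i hi => (h i hi).2]

/-- Only the identity permutation carries one strictly decreasing sequence to another. -/
theorem coeff_alternant_vars {α β : Fin N → ℕ} (hα : StrictAnti α) (hβ : StrictAnti β) :
    coeff (extendExponent α) (alternant (vars N) β) = if α = β then 1 else 0 := by
  classical
  have h1 : ∀ σ : Equiv.Perm (Fin N), ∏ i, vars N (σ i) ^ β i =
      monomial (extendExponent (β ∘ σ.symm)) 1 := fun σ => by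
    rw [← prod_vars_pow]
    exact Fintype.prod_equiv σ _ _ fun i => by simp
  have h2 : ∀ σ : Equiv.Perm (Fin N), extendExponent α = extendExponent (β ∘ σ.symm) →
      σ = 1 ∧ α = β := by
    intro σ h
    have h3 : ∀ i, α (σ i) = β i := fun i => by
      have := DFunLike.congr_fun h ((σ i : Fin N) : ℕ)
      simpa only [extendExponent_apply, Function.comp_apply, Equiv.symm_apply_apply] using this
    have h4 : StrictMono σ := fun i j hij => by
      rw [← hα.lt_iff_gt, h3, h3]
      exact hβ hij
    have h5 : (σ : Fin N → Fin N) = id :=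
      (h4.range_inj strictMono_id).1 (by simp [σ.surjective.range_eq])
    refine ⟨Equiv.ext fun i => congrFun h5 i, funext fun i => ?_⟩
    rw [← h3, h5, id]
  rw [alternant_eq_sum, map_sum, Finset.sum_eq_single 1]
  · rw [h1, Equiv.Perm.sign_one, one_smul, coeff_monomial]
    refine if_congr ⟨fun h => (h2 1 h).2, ?_⟩ rfl rfl
    rintro rfl
    rfl
  · intro σ _ hσ
    rw [h1, Units.smul_def, map_zsmul, coeff_monomial, if_neg fun h => hσ (h2 σ h).1, smul_zero]
  · simp

theorem strictAnti_add_staircase {f : ℕ → ℕ} (hf : Antitone f) :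
    StrictAnti fun i : Fin N => f i + (N - 1 - i) := by
  intro i j hij
  have := hf (Fin.lt_def.1 hij).le
  have h := Fin.lt_def.1 hij
  dsimp only
  omega

theorem alternant_vars_ne_zero (N : ℕ) :
    alternant (vars N) (fun i => N - 1 - i) ≠ 0 := by
  intro h
  have h1 : StrictAnti fun i : Fin N => N - 1 - (i : ℕ) := by
    simpa using strictAnti_add_staircase (N := N) (f := 0) fun _ _ _ => le_rfl
  have := coeff_alternant_vars h1 h1
  simp [h] at this

end Coefficients

/-! ### The Littlewood–Richardson rule -/

/-- The semistandard tableaux of shape `ν` that are good for the parts of `μ`. -/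
abbrev GoodTableau (μ ν : YoungDiagram) : Type :=
  {T : SemistandardYoungTableau ν // IsGood μ.rowLen T}

/-- Beyond the rows of `μ` goodness makes the content itself decrease, so every value from `μ.colLen
0` up to a given entry occurs in `T`. Hence finitely many variables see all good tableaux. -/
theorem GoodTableau.apply_lt {μ ν : YoungDiagram} (T : GoodTableau μ ν) {i c : ℕ}
    (hc : (i, c) ∈ ν) : T.1 i c < μ.colLen 0 + ν.cells.card := by
  have h : ∀ d w, w + d = T.1 i c → μ.colLen 0 ≤ w → 0 < content T.1 w := by
    intro d
    induction d with
    | zero =>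
      rintro w rfl -
      rw [← upperCount_zero]
      exact upperCount_pos T.1 hc (Nat.zero_le c)
    | succ d ih =>
      intro w hw hμ
      have h1 := ih (w + 1) (by omega) (by omega)
      have h2 := T.2 0 w
      rw [upperCount_zero, upperCount_zero, (rowLen_eq_zero_iff μ w).2 hμ] at h2
      omega
  have h1 : Finset.Icc (μ.colLen 0) (T.1 i c) ⊆ ν.cells.image fun c => T.1 c.1 c.2 := by
    intro w hw
    rw [Finset.mem_Icc] at hw
    have h2 := h (T.1 i c - w) w (by omega) hw.1
    rw [← upperCount_zero] at h2
    obtain ⟨a, e, hae, -, hT⟩ := exists_of_upperCount_pos T.1 h2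
    exact Finset.mem_image.2 ⟨(a, e), hae, hT⟩
  have h2 := (Finset.card_le_card h1).trans Finset.card_image_le
  have h3 : 0 < ν.cells.card := Finset.card_pos.2 ⟨_, hc⟩
  rw [Nat.card_Icc] at h2
  omega

instance (μ ν : YoungDiagram) : Finite (GoodTableau μ ν) :=
  Finite.of_injective (β := BoundedTableau (μ.colLen 0 + ν.cells.card) ν)
    (fun T => ⟨T.1, fun _ _ hc => T.apply_lt hc⟩) fun _ _ h =>
      Subtype.ext (congrArg (fun T : BoundedTableau _ ν => T.1) h)

noncomputable instance (μ ν : YoungDiagram) : Fintype (GoodTableau μ ν) := Fintype.ofFinite _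

theorem schurEval_vars_mul {N : ℕ} {μ : YoungDiagram} (ν : YoungDiagram)
    (hN : μ.colLen 0 + ν.cells.card ≤ N) :
    schurEval (vars N) μ * schurEval (vars N) ν =
      ∑ T : GoodTableau μ ν, schurEval (vars N) (addContent μ T.1) := by
  classical
  have h := mul_left_cancel₀ (alternant_vars_ne_zero N)
    (alternant_mul_schurEval_mul_schurEval (vars N) (μ := μ) (by omega) ν)
  rw [h]
  refine Finset.sum_bij (fun T hT => ⟨T.1, (Finset.mem_filter.1 hT).2⟩) ?_ ?_ ?_ ?_
  · simp
  · intro T hT T' hT' he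
    exact Subtype.ext (congrArg (fun T : GoodTableau μ ν => T.1) he)
  · intro T _
    exact ⟨⟨T.1, fun i c hc => (T.apply_lt hc).trans_le hN⟩, by simp [T.2], rfl⟩
  · intros
    rfl

theorem schur_mul_schur (μ ν : YoungDiagram) :
    schur μ * schur ν = ∑ T : GoodTableau μ ν, schur (addContent μ T.1) := by
  refine MvPowerSeries.ext fun m => ?_
  -- Enough variables for all entries of good tableaux and for the monomial `m`.
  let N := μ.colLen 0 + ν.cells.card + (m.support.sup id + 1)
  have hm : ∀ i, N ≤ i → m i = 0 := by
    intro i hi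
    by_contra h
    have := Finset.le_sup (f := id) (Finsupp.mem_support_iff.2 h)
    simp only [id, N] at this hi
    omega
  have h := congrArg (MvPowerSeries.coeff m)
    (schurEval_vars_mul (N := N) (μ := μ) ν (Nat.le_add_right _ _))
  rw [coeff_mul_congr (fun m hm => coeff_schurEval_vars μ hm)
    (fun m hm => coeff_schurEval_vars ν hm) hm] at h
  rw [h, map_sum, map_sum]
  exact Finset.sum_congr rfl fun T _ => coeff_schurEval_vars _ hm

/-- Multiplication by the Vandermonde alternant turns Schur functions into alternants, and the
coefficient at `θ` plus the staircase isolates the one for `θ`. -/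
theorem linearIndependent_schur : LinearIndependent ℕ schur := by
  classical
  have key : ∀ (c : YoungDiagram →₀ ℕ) (θ : YoungDiagram) (N : ℕ), θ.colLen 0 ≤ N →
      (∀ κ ∈ c.support, κ.colLen 0 ≤ N) →
      MvPowerSeries.coeff (extendExponent fun i : Fin N => θ.rowLen i + (N - 1 - i))
        (alternant (vars N) (fun i => N - 1 - i) * Finsupp.linearCombination ℕ schur c) =
          (c θ : ℤ) := by
    intro c θ N hθ hc
    rw [Finsupp.linearCombination_apply, Finsupp.sum, Finset.mul_sum, map_sum]
    have h1 : ∀ κ ∈ c.support,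
        MvPowerSeries.coeff (extendExponent fun i : Fin N => θ.rowLen i + (N - 1 - i))
          (alternant (vars N) (fun i => N - 1 - i) * c κ • schur κ) =
            if κ = θ then (c θ : ℤ) else 0 := by
      intro κ hκ
      rw [mul_smul_comm, map_nsmul, coeff_mul_congr (fun _ _ => rfl)
        (fun m hm => (coeff_schurEval_vars κ hm).symm)
        (fun i hi => extendExponent_apply_of_le _ hi), alternant_mul_schurEval_eq _ (hc κ hκ),
        coeff_alternant_vars (strictAnti_add_staircase fun i j => θ.rowLen_anti i j)
          (strictAnti_add_staircase fun i j => κ.rowLen_anti i j)]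
      by_cases h : κ = θ
      · subst h
        simp
      · rw [if_neg, if_neg h, smul_zero]
        intro he
        refine h (ext_rowLen fun i => ?_)
        by_cases hi : i < N
        · have := congrFun he ⟨i, hi⟩
          simp only at this
          omega
        · rw [(rowLen_eq_zero_iff κ i).2 ((hc κ hκ).trans (not_lt.1 hi)),
            (rowLen_eq_zero_iff θ i).2 (hθ.trans (not_lt.1 hi))]
    rw [Finset.sum_congr rfl h1, Finset.sum_ite_eq']
    split_ifs with h
    · rfl
    · rw [Finsupp.notMem_support_iff.1 h, Nat.cast_zero]
  intro c d hcd
  ext θ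
  let N := (insert θ (c.support ∪ d.support)).sup fun κ => κ.colLen 0
  have hN : ∀ κ ∈ insert θ (c.support ∪ d.support), κ.colLen 0 ≤ N :=
    fun κ hκ => Finset.le_sup (f := fun κ : YoungDiagram => κ.colLen 0) hκ
  have hc := key c θ N (hN θ (Finset.mem_insert_self _ _)) fun κ hκ =>
    hN κ (Finset.mem_insert_of_mem (Finset.mem_union_left _ hκ))
  have hd := key d θ N (hN θ (Finset.mem_insert_self _ _)) fun κ hκ =>
    hN κ (Finset.mem_insert_of_mem (Finset.mem_union_right _ hκ))
  rw [hcd, hd] at hc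
  exact_mod_cast hc.symm

/-- The Littlewood–Richardson coefficients of `schur μ * schur ν`. -/
noncomputable def lrCoeff (μ ν : YoungDiagram) : YoungDiagram →₀ ℕ :=
  ∑ T : GoodTableau μ ν, Finsupp.single (addContent μ T.1) 1

theorem linearCombination_lrCoeff (μ ν : YoungDiagram) :
    Finsupp.linearCombination ℕ schur (lrCoeff μ ν) = schur μ * schur ν := by
  rw [schur_mul_schur, lrCoeff, map_sum]
  simp

theorem lrCoeff_apply (μ ν θ : YoungDiagram) :
    lrCoeff μ ν θ = Nat.card {T : GoodTableau μ ν // addContent μ T.1 = θ} := by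
  classical
  rw [lrCoeff, Finsupp.finsetSum_apply, Nat.card_eq_fintype_card, Fintype.card_subtype,
    Finset.card_filter]
  simp only [Finsupp.single_apply]

theorem isSchurPositive_schur_mul_sub_iff (lam rh μ ν : YoungDiagram) :
    IsSchurPositive (schur lam * schur rh - schur μ * schur ν) ↔
      lrCoeff μ ν ≤ lrCoeff lam rh := by
  constructor
  · rintro ⟨c, hc⟩
    have h : lrCoeff lam rh = lrCoeff μ ν + c := by
      refine linearIndependent_schur ?_
      rw [map_add, linearCombination_lrCoeff, linearCombination_lrCoeff,
        Finsupp.linearCombination_apply, ← hc]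
      ring
    rw [h]
    exact le_self_add
  · intro h
    refine ⟨lrCoeff lam rh - lrCoeff μ ν, ?_⟩
    rw [← Finsupp.linearCombination_apply, sub_eq_iff_eq_add,
      ← linearCombination_lrCoeff, ← linearCombination_lrCoeff, ← map_add, tsub_add_cancel_of_le h]

/-! ### Lengthening the first rows -/

/-- `μ` is obtained from `α` by adding one cell to each of the rows `0, …, k`. -/
def IsRaise (k : ℕ) (α μ : YoungDiagram) : Prop :=
  ∀ i, μ.rowLen i = α.rowLen i + if i ≤ k then 1 else 0

section Raise

variable {k : ℕ} {α μ ν : YoungDiagram}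

theorem IsRaise.eq_right {θ θ₁ θ₂ : YoungDiagram} (h₁ : IsRaise k θ θ₁) (h₂ : IsRaise k θ θ₂) :
    θ₁ = θ₂ :=
  ext_rowLen fun i => (h₁ i).trans (h₂ i).symm

theorem IsRaise.eq_left {θ θ₁ θ₂ : YoungDiagram} (h₁ : IsRaise k θ₁ θ) (h₂ : IsRaise k θ₂ θ) :
    θ₁ = θ₂ :=
  ext_rowLen fun i => Nat.add_right_cancel ((h₁ i).symm.trans (h₂ i))

theorem IsRaise.isGood (h : IsRaise k α μ) {T : SemistandardYoungTableau ν}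
    (hT : IsGood α.rowLen T) : IsGood μ.rowLen T := by
  intro j m
  have := hT j m
  rw [h, h]
  split_ifs <;> omega

/-- The inequalities for `α` and `μ` differ only at index `k`, where the gap exceeds or equals
anything `T` can add to row `k + 1`. -/
theorem IsRaise.isGood_of_gap (h : IsRaise k α μ)
    (hgap : α.rowLen (k + 1) + ν.rowLen 0 ≤ α.rowLen k) {T : SemistandardYoungTableau ν}
    (hT : IsGood μ.rowLen T) : IsGood α.rowLen T := by
  intro j m
  have h1 := hT j m
  rw [h, h] at h1
  obtain rfl | hm := eq_or_ne m k
  · have := upperCount_le_rowLen T j (m + 1)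
    omega
  · split_ifs at h1 <;> omega

theorem IsRaise.addContent (h : IsRaise k α μ) {T : SemistandardYoungTableau ν}
    (hT : IsGood α.rowLen T) : IsRaise k (addContent α T) (addContent μ T) := by
  intro i
  rw [rowLen_addContent hT, rowLen_addContent (h.isGood hT), h i]
  omega

theorem IsRaise.lrCoeff_le (h : IsRaise k α μ) {θ θ' : YoungDiagram} (hθ : IsRaise k θ θ')
    (ν : YoungDiagram) : lrCoeff α ν θ ≤ lrCoeff μ ν θ' := by
  rw [lrCoeff_apply, lrCoeff_apply]
  refine Nat.card_le_card_of_injective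
    (fun T => ⟨⟨T.1.1, h.isGood T.1.2⟩, (h.addContent T.1.2).eq_right (by rw [T.2]; exact hθ)⟩) ?_
  intro T T' hT
  simp only [Subtype.mk.injEq] at hT
  exact Subtype.ext (Subtype.ext hT)

/-- With the gap, `μ` and `α` have the same good tableaux, so every shape occurring for `μ` is the
raise of one occurring for `α`. -/
theorem IsRaise.exists_lrCoeff_le (h : IsRaise k α μ)
    (hgap : α.rowLen (k + 1) + ν.rowLen 0 ≤ α.rowLen k) {θ' : YoungDiagram}
    (hθ' : lrCoeff μ ν θ' ≠ 0) :
    ∃ θ, IsRaise k θ θ' ∧ lrCoeff μ ν θ' ≤ lrCoeff α ν θ := by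
  simp only [lrCoeff_apply] at hθ' ⊢
  obtain ⟨⟨T₀, hT₀⟩⟩ := (Nat.card_ne_zero.1 hθ').1
  have hθ : IsRaise k (FFLP.addContent α T₀.1) θ' :=
    hT₀ ▸ h.addContent (h.isGood_of_gap hgap T₀.2)
  refine ⟨_, hθ, Nat.card_le_card_of_injective (fun T => ⟨⟨T.1.1, h.isGood_of_gap hgap T.1.2⟩,
    IsRaise.eq_left (θ := θ')
      (by have := h.addContent (h.isGood_of_gap hgap T.1.2); rwa [T.2] at this) hθ⟩) ?_⟩
  intro T T' hT
  simp only [Subtype.mk.injEq] at hT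
  exact Subtype.ext (Subtype.ext hT)

/-! ### The `*`-operation under lengthening of rows -/

theorem IsRaise.colLen_eq (h : IsRaise k α μ) (hk : 0 < α.rowLen k) :
    μ.colLen 0 = α.colLen 0 := by
  refine eq_of_forall_ge_iff fun i => ?_
  rw [← rowLen_eq_zero_iff, ← rowLen_eq_zero_iff, h i]
  split_ifs with hi
  · have := α.rowLen_anti i k hi
    exact iff_of_false not_false (by omega)
  · rfl

theorem IsRaise.shifted (h : IsRaise k α μ) (i : ℕ) :
    shifted μ i = shifted α i + if i ≤ k then 1 else 0 := by
  unfold FFLP.shifted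
  rw [h i]
  push_cast
  ring

theorem shifted_lt_of_gap (hgap : ν.rowLen 0 + (k + 1) ≤ α.rowLen k) {i : ℕ} (hi : i ≤ k)
    (j : ℕ) : shifted ν j < shifted α i := by
  have h1 := α.rowLen_anti i k hi
  have h2 := ν.rowLen_anti 0 j (Nat.zero_le j)
  unfold shifted
  omega

/-- For `i ≤ k` the count is zero before and after raising; for `i > k` the shifted part does not
move. -/
theorem IsRaise.lambdaPart (h : IsRaise k α μ) (hgap : ν.rowLen 0 + (k + 1) ≤ α.rowLen k)
    (i : ℕ) : lambdaPart μ ν i = lambdaPart α ν i + if i ≤ k then 1 else 0 := by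
  have hn : numParts μ ν = numParts α ν := by
    unfold numParts
    rw [h.colLen_eq (by omega)]
  unfold FFLP.lambdaPart
  rw [hn, h.shifted i]
  split_ifs with hi
  · have h1 := shifted_lt_of_gap (ν := ν) hgap hi
    rw [Finset.filter_false_of_mem, Finset.filter_false_of_mem]
    · simp
    · exact fun j _ => not_le.2 (h1 j)
    · intro j _
      have := h1 j
      omega
  · simp

theorem IsRaise.rhoPart (h : IsRaise k α μ) (hgap : ν.rowLen 0 + (k + 1) ≤ α.rowLen k)
    (i : ℕ) : rhoPart μ ν i = rhoPart α ν i := by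
  have hn : numParts μ ν = numParts α ν := by
    unfold numParts
    rw [h.colLen_eq (by omega)]
  unfold FFLP.rhoPart
  rw [hn]
  congr 3
  refine Finset.filter_congr fun j _ => ?_
  rw [h.shifted j]
  split_ifs with hj
  · have := shifted_lt_of_gap (ν := ν) hgap hj i
    omega
  · rw [add_zero]

theorem lambda_rowLen_of_le {i : ℕ} (hi : numParts μ ν ≤ i) : (lambda μ ν).rowLen i = 0 := by
  by_contra h
  have := YoungDiagram.mem_iff_lt_rowLen.2 (Nat.pos_of_ne_zero h)
  obtain ⟨h1, -⟩ := YoungDiagram.mem_ofRowLens.1 this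
  simp only [List.length_map, List.length_range] at h1
  omega

theorem rho_rowLen_of_le {i : ℕ} (hi : numParts μ ν ≤ i) : (rho μ ν).rowLen i = 0 := by
  by_contra h
  have := YoungDiagram.mem_iff_lt_rowLen.2 (Nat.pos_of_ne_zero h)
  obtain ⟨h1, -⟩ := YoungDiagram.mem_ofRowLens.1 this
  simp only [List.length_map, List.length_range] at h1
  omega

theorem IsRaise.lambda (h : IsRaise k α μ) (hgap : ν.rowLen 0 + (k + 1) ≤ α.rowLen k) :
    IsRaise k (lambda α ν) (lambda μ ν) := by
  have hn : numParts μ ν = numParts α ν := by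
    unfold numParts
    rw [h.colLen_eq (by omega)]
  intro i
  by_cases hi : i < numParts α ν
  · have h1 := lambda_rowLen α ν hi
    have h2 := lambda_rowLen μ ν (hn ▸ hi)
    rw [h.lambdaPart hgap] at h2
    split_ifs at h2 ⊢ <;> omega
  · rw [lambda_rowLen_of_le (by omega), lambda_rowLen_of_le (by omega), if_neg]
    intro hik
    have h1 := α.rowLen_anti i k hik
    have h2 := (rowLen_eq_zero_iff α i).2 ((le_max_left _ _).trans (not_lt.1 hi))
    omega

theorem IsRaise.rho (h : IsRaise k α μ) (hgap : ν.rowLen 0 + (k + 1) ≤ α.rowLen k) :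
    rho μ ν = rho α ν := by
  have hn : numParts μ ν = numParts α ν := by
    unfold numParts
    rw [h.colLen_eq (by omega)]
  refine ext_rowLen fun i => ?_
  by_cases hi : i < numParts α ν
  · have h1 := rho_rowLen α ν hi
    have h2 := rho_rowLen μ ν (hn ▸ hi)
    rw [h.rhoPart hgap] at h2
    omega
  · rw [rho_rowLen_of_le (by omega), rho_rowLen_of_le (by omega)]

/-- For `θ'` the raise of `θ`, the coefficients satisfy `c(μ, ν; θ') ≤ c(α, ν; θ) ≤ c(λ(α), ρ; θ) ≤
c(λ(μ), ρ; θ')`: by the gap, by the conjecture for `α`, and by monotonicity under raising. -/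
theorem IsRaise.conjectureHolds (h : IsRaise k α μ)
    (hgap : α.rowLen (k + 1) + ν.rowLen 0 + (k + 1) ≤ α.rowLen k) (hα : ConjectureHolds α ν) :
    ConjectureHolds μ ν := by
  unfold ConjectureHolds at hα ⊢
  rw [isSchurPositive_schur_mul_sub_iff] at hα ⊢
  intro θ'
  obtain h0 | h0 := eq_or_ne (lrCoeff μ ν θ') 0
  · rw [h0]
    exact Nat.zero_le _
  · obtain ⟨θ, hθ, hle⟩ := h.exists_lrCoeff_le (by omega) h0
    rw [h.rho (by omega)]
    exact hle.trans ((hα θ).trans ((h.lambda (by omega)).lrCoeff_le hθ _))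

theorem exists_isRaise (hgap : μ.rowLen (k + 1) < μ.rowLen k) : ∃ α, IsRaise k α μ := by
  let f : ℕ →₀ ℕ := Finsupp.onFinset (Finset.range (μ.colLen 0))
    (fun i => μ.rowLen i - if i ≤ k then 1 else 0) (by
      intro i hi
      rw [Finset.mem_range, ← not_le, ← rowLen_eq_zero_iff]
      omega)
  have hf : ∀ i, f i = μ.rowLen i - if i ≤ k then 1 else 0 := fun _ => rfl
  refine ⟨ofRows f, fun i => ?_⟩
  rw [rowLen_ofRows, hf]
  · have := μ.rowLen_anti i k
    split_ifs <;> omega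
  · refine antitone_nat_of_succ_le fun m => ?_
    have h1 := μ.rowLen_anti m (m + 1) (Nat.le_add_right m 1)
    rw [hf, hf]
    obtain rfl | hm := eq_or_ne m k
    · split_ifs <;> omega
    · split_ifs <;> omega

/-- The first part is the sum of the `p` successive differences, so they cannot all be at most `d`.
-/
theorem exists_gap {p d : ℕ} (hμ : μ.colLen 0 ≤ p) (hd : p * d < μ.rowLen 0) :
    ∃ k < p, μ.rowLen (k + 1) + d < μ.rowLen k := by
  by_contra! h
  have key : ∀ i ≤ p, μ.rowLen 0 ≤ μ.rowLen i + i * d := by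
    intro i
    induction i with
    | zero => simp
    | succ i ih =>
      intro hi
      have h1 := ih (by omega)
      have h2 := h i hi
      rw [Nat.succ_mul]
      omega
  have h1 := key p le_rfl
  rw [(rowLen_eq_zero_iff μ p).2 hμ] at h1
  omega

end Raise

theorem finite_setOf_colLen_le_rowLen_le (p m : ℕ) :
    {α : YoungDiagram | α.colLen 0 ≤ p ∧ α.rowLen 0 ≤ m}.Finite := by
  have hinj : Function.Injective YoungDiagram.cells := fun _ _ h => YoungDiagram.ext h
  refine ((Finset.range p ×ˢ Finset.range m).powerset.finite_toSet.preimage hinj.injOn).subset ?_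
  rintro α ⟨h1, h2⟩
  simp only [Set.mem_preimage, Finset.coe_powerset, Set.mem_powerset_iff, Finset.coe_subset]
  rintro ⟨i, c⟩ hc
  rw [YoungDiagram.mem_cells] at hc
  have h3 := YoungDiagram.mem_iff_lt_colLen.1 (α.up_left_mem le_rfl (Nat.zero_le c) hc)
  have h4 := YoungDiagram.mem_iff_lt_rowLen.1 (α.up_left_mem (Nat.zero_le i) le_rfl hc)
  simp only [Finset.mem_product, Finset.mem_range]
  omega

end FFLP

theorem theorem3p2 (p : ℕ) (hp : 0 < p) (ν : YoungDiagram) (hν : ν.colLen 0 ≤ p) :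
    {α : YoungDiagram | α.colLen 0 ≤ p ∧ α.rowLen 0 ≤ p * (ν.rowLen 0 + p)}.Finite ∧
    ((∀ μ : YoungDiagram, μ.colLen 0 ≤ p → FFLP.ConjectureHolds μ ν) ↔
      (∀ α : YoungDiagram, α.colLen 0 ≤ p → α.rowLen 0 ≤ p * (ν.rowLen 0 + p) →
        FFLP.ConjectureHolds α ν)) := by
  refine ⟨FFLP.finite_setOf_colLen_le_rowLen_le p _, fun h α hα _ => h α hα, fun h μ => ?_⟩
  induction hm : μ.rowLen 0 using Nat.strong_induction_on generalizing μ with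
  | _ m ih =>
    intro hμ
    by_cases hle : μ.rowLen 0 ≤ p * (ν.rowLen 0 + p)
    · exact h μ hμ hle
    -- Here `d = ν.rowLen 0 + p`. The strict inequality survives as `≤` after row `k` loses a cell,
    -- and `k + 1 ≤ p` supplies the gap that `IsRaise.conjectureHolds` needs.
    · obtain ⟨k, hk, hgap⟩ := FFLP.exists_gap hμ (not_le.1 hle)
      obtain ⟨α, hα⟩ := FFLP.exists_isRaise (k := k) (μ := μ) (by omega)
      have h0 := hα 0
      have h1 := hα k
      have h2 := hα (k + 1)
      rw [if_pos (Nat.zero_le k)] at h0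
      rw [if_pos le_rfl] at h1
      rw [if_neg (by omega)] at h2
      refine hα.conjectureHolds (by omega) (ih (α.rowLen 0) (by omega) α rfl ?_)
      rw [← hα.colLen_eq (by omega)]
      exact hμ
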